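/- Let $n\ge 0$ be an integer and let $F_n$ be the free group of rank $n$. The rank $\operatorname{rk}(G)\in\{0,1,2,\dots\}\cup\{\infty\}$ of a group $G$ is the smallest cardinality of a generating set of $G$, all infinite values being written $\infty$. A $\oplus$-complement of a subgroup $H\le F_n$ is a subgroup $K\le F_n$ with $H\cap K=\{1\}$ and $\langle H\cup K\rangle=F_n$; $H$ is $\oplus$-complementable if it has one, and then its $\oplus$-corank, $\operatorname{crk}_\oplus(H)$, is the minimum of $\operatorname{rk}(K)$ over all $\oplus$-complements $K$ of $H$. (1) For every finitely generated $\oplus$-complementable subgroup $H\le F_n$, $$\max\{0,\,n-\operatorname{rk}(H)\}\ \le\ \operatorname{crk}_\oplus(H)\ \le\ n,$$ and the lower bound holds for every $\oplus$-complementable subgroup $H\le F_n$, finitely generated or not (with $n-\infty$ read as $-\infty$). (2) If $n>1$, then for every $r\in\{1,2,\dots\}\cup\{\infty\}$ and every integer $c$ with $1\le c\le n$ and $n-r\le c$, there is a $\oplus$-complementable subgroup $H\le F_n$ with $\operatorname{rk}(H)=r$ and $\operatorname{crk}_\oplus(H)=c$. -/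

import Mathlib

/-- The rank of a group: the smallest cardinality of a generating set, with value `⊤` for a group
that is not finitely generated (for the countable groups considered here, `⊤` stands for `ℵ₀`). -/
noncomputable def groupRank (G : Type*) [Group G] : ℕ∞ :=
  ⨅ S : {S : Set G // Subgroup.closure S = ⊤}, S.1.encard

/-- The direct corank of `H ≤ G`: the minimum rank of a direct complement of `H`, that is, of a
subgroup `K` with `H ⊓ K = ⊥` and `H ⊔ K = ⊤` (which is `IsCompl H K` in the lattice of subgroups).
The infimum is a minimum as soon as `H` has a direct complement; otherwise it is `⊤`. -/
noncomputable def directCorank {G : Type*} [Group G] (H : Subgroup G) : ℕ∞ :=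
  ⨅ K : {K : Subgroup G // IsCompl H K}, groupRank K.1

/-! Linear independence in the rational abelianization shows that `FreeGroup (Fin n)` has rank at
least `n`, and generators of `H` and `K` together generate it; hence the lower bound.

For the upper bound, a complement of a finite-index `H` is finite, hence trivial, and `H = ⊥` has
the complement `⊤`. Otherwise some conjugate of `H` has all nontrivial elements ending in one letter
`b^±1` (`exists_allEndIn_conj`): seen from far out in a hanging tree of the Schreier graph, every
loop returns through the same edge. Multiplying generators that neither start nor end in `b^±1` on
both sides by distinct elements of `H` then gives generators of a complement, since no cancellation
is left (`AllEndIn.exists_isCompl`).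

For the realization, `H` is generated by conjugates `b^k i b^-k` or quotients of them. A map to a
wreath product sends these to independent vectors, which gives the rank; a map to a vector space
killing `H` bounds the corank from below. -/

/-! ### Ranks and generating sets -/

theorem groupRank_closure_le {G : Type*} [Group G] (S : Set G) :
    groupRank (Subgroup.closure S) ≤ S.encard := by
  refine (iInf_le _ ⟨((↑) : Subgroup.closure S → G) ⁻¹' S,
    Subgroup.closure_closure_coe_preimage⟩).trans ?_
  rw [← Function.Injective.encard_image Subtype.val_injective]
  exact Set.encard_le_encard (Set.image_preimage_subset _ _)

theorem groupRank_closure_range_le {G ι : Type*} [Group G] (u : ι → G) :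
    groupRank (Subgroup.closure (Set.range u)) ≤ ENat.card ι := by
  refine (groupRank_closure_le _).trans ?_
  rw [← Set.image_univ, ← Set.encard_univ]
  exact Set.encard_image_le _ _

theorem groupRank_le_encard {G : Type*} [Group G] {K : Subgroup G} {S : Set G}
    (h : Subgroup.closure S = K) : groupRank K ≤ S.encard :=
  h ▸ groupRank_closure_le S

theorem directCorank_le {G : Type*} [Group G] {H K : Subgroup G} (h : IsCompl H K) :
    directCorank H ≤ groupRank K :=
  iInf_le (fun K : {K : Subgroup G // IsCompl H K} => groupRank K.1) ⟨K, h⟩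

theorem exists_encard_eq_groupRank (G : Type*) [Group G] :
    ∃ S : Set G, Subgroup.closure S = ⊤ ∧ S.encard = groupRank G := by
  have : Nonempty {S : Set G // Subgroup.closure S = ⊤} := ⟨⟨Set.univ, Subgroup.closure_univ⟩⟩
  obtain ⟨S, hS⟩ := ENat.exists_eq_iInf (fun S : {S : Set G // Subgroup.closure S = ⊤} => S.1.encard)
  exact ⟨S.1, S.2, hS⟩

theorem groupRank_map_le {G G' : Type*} [Group G] [Group G'] (f : G →* G') (K : Subgroup G) :
    groupRank (K.map f) ≤ groupRank K := by
  obtain ⟨S, hS, hSc⟩ := exists_encard_eq_groupRank K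
  have h : Subgroup.closure (f '' (K.subtype '' S)) = K.map f := by
    rw [← MonoidHom.map_closure, ← MonoidHom.map_closure, hS, ← MonoidHom.range_eq_map,
      K.range_subtype]
  rw [← hSc]
  exact (groupRank_le_encard h).trans ((Set.encard_image_le _ _).trans (Set.encard_image_le _ _))

theorem groupRank_bot (G : Type*) [Group G] : groupRank (⊥ : Subgroup G) = 0 := by
  simpa using groupRank_le_encard (Subgroup.closure_empty (G := G))

theorem groupRank_le_of_closure_eq_top {G : Type*} [Group G] {S : Set G}
    (hS : Subgroup.closure S = ⊤) : groupRank G ≤ S.encard :=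
  iInf_le (fun S : {S : Set G // Subgroup.closure S = ⊤} => S.1.encard) ⟨S, hS⟩

theorem groupRank_le_add {G : Type*} [Group G] {H K : Subgroup G} (h : H ⊔ K = ⊤) :
    groupRank G ≤ groupRank H + groupRank K := by
  obtain ⟨S, hS, hSc⟩ := exists_encard_eq_groupRank H
  obtain ⟨T, hT, hTc⟩ := exists_encard_eq_groupRank K
  have hST : Subgroup.closure (H.subtype '' S ∪ K.subtype '' T) = ⊤ := by
    rw [Subgroup.closure_union, ← MonoidHom.map_closure, ← MonoidHom.map_closure, hS, hT,
      ← MonoidHom.range_eq_map, ← MonoidHom.range_eq_map, H.range_subtype, K.range_subtype, h]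
  rw [← hSc, ← hTc]
  exact (groupRank_le_of_closure_eq_top hST).trans <| (Set.encard_union_le _ _).trans <|
    add_le_add (Set.encard_image_le _ _) (Set.encard_image_le _ _)

/-! ### Lower bounds from linear independence -/

/-- A homomorphism to a vector space bounds the rank of a group from below. -/
theorem card_le_groupRank {G V ι : Type*} [Group G] [AddCommGroup V] [Module ℚ V]
    (f : G →* Multiplicative V) (g : ι → G)
    (hg : LinearIndependent ℚ fun i => (f (g i)).toAdd) : ENat.card ι ≤ groupRank G := by
  refine le_iInf fun S => ?_
  obtain ⟨S, hS⟩ := S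
  rcases S.finite_or_infinite with hfin | hinf
  · set w : Set V := (fun x => (f x).toAdd) '' S
    have hw : w.Finite := hfin.image _
    have hspan : ∀ x : G, (f x).toAdd ∈ Submodule.span ℚ w := by
      intro x
      have hx : x ∈ Subgroup.closure S := hS ▸ Subgroup.mem_top x
      induction hx using Subgroup.closure_induction with
      | mem x hx => exact Submodule.subset_span ⟨x, hx, rfl⟩
      | one => simp
      | mul x y _ _ hx hy => simpa using add_mem hx hy
      | inv x _ hx => simpa using hx
    let _ := hw.fintype
    have hle := linearIndependent_le_span' _ hg w (by rintro _ ⟨i, rfl⟩; exact hspan _)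
    have : Finite ι := by
      rw [← Cardinal.lt_aleph0_iff_finite]
      exact hle.trans_lt (Cardinal.natCast_lt_aleph0)
    have h1 : ENat.card ι ≤ w.encard := by
      rw [Set.encard, ENat.card_eq_coe_natCard, ENat.card_eq_coe_fintype_card]
      rw [← Nat.cast_card (α := ι)] at hle
      exact_mod_cast hle
    exact h1.trans (Set.encard_image_le _ _)
  · simp [hinf.encard_eq]

/-- The total exponents of the letters in an element of a free group. -/
noncomputable def FreeGroup.exponents {α β : Type*} (f : α → β →₀ ℚ) :
    FreeGroup α →* Multiplicative (β →₀ ℚ) :=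
  FreeGroup.lift fun i => Multiplicative.ofAdd (f i)

theorem card_le_groupRank_freeGroup (α : Type*) : ENat.card α ≤ groupRank (FreeGroup α) := by
  refine card_le_groupRank (FreeGroup.exponents fun i : α => Finsupp.single i 1) FreeGroup.of ?_
  simpa [FreeGroup.exponents] using Finsupp.linearIndependent_single_one ℚ α

theorem sub_groupRank_le_directCorank {n : ℕ} (H : Subgroup (FreeGroup (Fin n))) :
    (n : ℕ∞) - groupRank H ≤ directCorank H := by
  refine le_iInf fun K => tsub_le_iff_left.2 (le_trans ?_ (groupRank_le_add K.2.sup_eq_top))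
  simpa using card_le_groupRank_freeGroup (Fin n)

/-- If a homomorphism to a vector space kills `H`, the dimension of its image bounds the corank. -/
theorem card_le_directCorank {G V ι : Type*} [Group G] [AddCommGroup V] [Module ℚ V]
    {H : Subgroup G} (f : G →* Multiplicative V) (hf : H ≤ f.ker) (g : ι → G)
    (hg : LinearIndependent ℚ fun i => (f (g i)).toAdd) : ENat.card ι ≤ directCorank H := by
  refine le_iInf fun K => ?_
  obtain ⟨K, hK⟩ := K
  -- Since `f` kills `H`, already `K` has the full image under `f`.
  have key : ∀ x : G, ∃ k : K, f k = f x := by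
    intro x
    have : x ∈ K ⊔ f.ker := by
      have h : (⊤ : Subgroup G) ≤ K ⊔ f.ker := by
        rw [← hK.sup_eq_top, sup_comm H K]
        exact sup_le_sup_left hf K
      exact h (Subgroup.mem_top x)
    obtain ⟨k, hk, y, hy, rfl⟩ := Subgroup.mem_sup_of_normal_right.1 this
    exact ⟨⟨k, hk⟩, by simp [f.mem_ker.1 hy]⟩
  choose k hk using key
  refine card_le_groupRank (f.comp K.subtype) (fun i => k (g i)) ?_
  simpa [hk] using hg

/-! ### Complements of subgroups whose elements end in one letter -/

namespace FreeGroup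

variable {α : Type*}

theorem isReduced_append {L M : List (α × Bool)} (hL : IsReduced L) (hM : IsReduced M)
    (h : ∀ x ∈ L.getLast?, ∀ y ∈ M.head?, x.1 ≠ y.1) : IsReduced (L ++ M) :=
  List.isChain_append.2 ⟨hL, hM, fun x hx y hy e => (h x hx y hy e).elim⟩

theorem getLast?_invRev (L : List (α × Bool)) :
    (invRev L).getLast? = L.head?.map fun x => (x.1, !x.2) := by
  simp [invRev]

theorem IsReduced.eq_of_mem [Subsingleton α] {x : α × Bool} {L : List (α × Bool)}
    (h : IsReduced (x :: L)) : ∀ y ∈ x :: L, y = x := by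
  induction L generalizing x with
  | nil => simp
  | cons z L ih =>
    obtain ⟨h1, h2⟩ := isReduced_cons_cons.1 h
    have hz : z = x := Prod.ext (Subsingleton.elim _ _) (h1 (Subsingleton.elim _ _)).symm
    intro y hy
    rcases List.mem_cons.1 hy with rfl | hy
    · rfl
    · exact (ih h2 y hy).trans hz

theorem eq_bot_of_finite (H : Subgroup (FreeGroup α)) [Finite H] : H = ⊥ := by
  rw [Subgroup.eq_bot_iff_forall]
  intro x hx
  have := (isOfFinOrder_of_finite (⟨x, hx⟩ : H)).eq_one'
  simpa using this

variable [DecidableEq α]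

theorem toWord_mk_of_isReduced {L : List (α × Bool)} (h : IsReduced L) : (mk L).toWord = L := by
  rw [toWord_mk, h.reduce_eq]

theorem toWord_mul_of_isReduced {x y : FreeGroup α} (h : IsReduced (x.toWord ++ y.toWord)) :
    (x * y).toWord = x.toWord ++ y.toWord := by
  rw [toWord_mul, h.reduce_eq]

/-- Every nontrivial element of `H` has a reduced word that ends in the letter `x`. -/
def AllEndIn (H : Subgroup (FreeGroup α)) (x : α × Bool) : Prop :=
  ∀ c ∈ H, c ≠ 1 → x ∈ c.toWord.getLast?

theorem AllEndIn.head {H : Subgroup (FreeGroup α)} {x : α × Bool} (h : AllEndIn H x)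
    {c : FreeGroup α} (hc : c ∈ H) (hc1 : c ≠ 1) : (x.1, !x.2) ∈ c.toWord.head? := by
  have := h c⁻¹ (inv_mem hc) (inv_ne_one.2 hc1)
  rw [toWord_inv, getLast?_invRev] at this
  simp only [Option.mem_def, Option.map_eq_some_iff] at this ⊢
  obtain ⟨y, hy, rfl⟩ := this
  simpa using hy

/-- The letter `l` conjugated by `a` if it is `b` or `b⁻¹`, and unchanged otherwise. -/
def shield (a b : α) (l : α × Bool) : FreeGroup α :=
  if l.1 = b then mk [(a, true), l, (a, false)] else mk [l]

theorem shield_spec {a b : α} (hab : a ≠ b) (l : α × Bool) :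
    (shield a b l).toWord ≠ [] ∧ (∀ x ∈ (shield a b l).toWord.head?, x.1 ≠ b) ∧
      ∀ x ∈ (shield a b l).toWord.getLast?, x.1 ≠ b := by
  unfold shield
  split_ifs with h
  · subst h
    rw [toWord_mk_of_isReduced (by simp [hab, hab.symm])]
    simp [hab]
  · rw [toWord_mk_of_isReduced (by simp)]
    simpa using h

theorem shield_not (a b i : α) : shield a b (i, false) = (shield a b (i, true))⁻¹ := by
  unfold shield
  split_ifs <;> simp [inv_mk, invRev]

theorem mem_of_forall_shield_mem {a b : α} (hab : a ≠ b) (M : Subgroup (FreeGroup α))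
    (h : ∀ i, shield a b (i, true) ∈ M) : M = ⊤ := by
  have hne : ∀ i, i ≠ b → of i ∈ M := fun i hi => by simpa [shield, hi, of] using h i
  rw [eq_top_iff, ← closure_range_of, Subgroup.closure_le]
  rintro _ ⟨i, rfl⟩
  by_cases hi : i = b
  · subst hi
    have hs : shield a i (i, true) = of a * of i * (of a)⁻¹ := by simp [shield, of, inv_mk, invRev]
    have h2 := M.mul_mem (M.mul_mem (M.inv_mem (hne a hab)) (h i)) (hne a hab)
    rw [hs] at h2
    simpa [mul_assoc] using h2
  · exact hne i hi

/-- Between consecutive shields stands a nontrivial element of `H`, which starts and ends in `b^±1`,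
while shields do neither; so nothing cancels. Without its final factor from `H`, the product ends in
a letter other than `b^±1`. In the induction, `g` is the part already read. -/
theorem shielded_product_not_mem {a b : α} (hab : a ≠ b) {e : Bool} {H : Subgroup (FreeGroup α)}
    (h : AllEndIn H (b, e)) {p : α × Bool → FreeGroup α} (hp : ∀ l, p l ∈ H)
    (hinj : Function.Injective p) {u : α → FreeGroup α}
    (hu : ∀ i, u i = p (i, true) * shield a b (i, true) * (p (i, false))⁻¹)
    (L : List (α × Bool)) (l : α × Bool) (hL : IsReduced (l :: L)) (g : FreeGroup α)
    (hg : ∀ x ∈ g.toWord.getLast?, x = (b, e)) :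
    g * shield a b l * (p (l.1, !l.2))⁻¹ * lift u (mk L) ∉ H := by
  obtain ⟨hne, hhead, hlast⟩ := shield_spec hab l
  have hgz : (g * shield a b l).toWord = g.toWord ++ (shield a b l).toWord := by
    refine toWord_mul_of_isReduced (isReduced_append isReduced_toWord isReduced_toWord ?_)
    intro x hx y hy
    rw [hg x hx]
    exact (hhead y hy).symm
  have hgl : (g * shield a b l).toWord.getLast? = (shield a b l).toWord.getLast? := by
    rw [hgz, List.getLast?_append_of_ne_nil _ hne]
  induction L generalizing g l with
  | nil =>
    intro hmem
    have hmem' : g * shield a b l ∈ H := by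
      rw [← one_eq_mk, _root_.map_one, mul_one] at hmem
      simpa using H.mul_mem hmem (hp (l.1, !l.2))
    have h1 : g * shield a b l ≠ 1 := by
      rw [Ne, ← toWord_eq_nil_iff, hgz]
      simp [hne]
    have h2 := h _ hmem' h1
    rw [hgl] at h2
    exact hlast _ h2 rfl
  | cons m L ih =>
    have hm : (lift u) (mk (m :: L)) =
        p m * shield a b m * (p (m.1, !m.2))⁻¹ * lift u (mk L) := by
      obtain ⟨i, t⟩ := m
      rw [← List.singleton_append, ← mul_mk, _root_.map_mul]
      congr 1
      cases t <;> simp [hu, shield_not, mul_assoc]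
    set c := (p (l.1, !l.2))⁻¹ * p m with hc
    have hcH : c ∈ H := H.mul_mem (H.inv_mem (hp _)) (hp _)
    have hred := isReduced_cons_cons.1 hL
    -- By injectivity of `p`, `c = 1` would make `m` the inverse of `l`, against reducedness.
    have hc1 : c ≠ 1 := by
      intro h1
      have h2 := hinj (inv_mul_eq_one.1 h1)
      have h3 := hred.1 (by rw [← h2])
      rw [← h2] at h3
      simp at h3
    have hw : (g * shield a b l * c).toWord = (g * shield a b l).toWord ++ c.toWord := by
      refine toWord_mul_of_isReduced (isReduced_append isReduced_toWord isReduced_toWord ?_)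
      intro x hx y hy
      rw [hgl] at hx
      have := h.head hcH hc1
      rw [Option.mem_def] at this hy
      rw [this, Option.some_inj] at hy
      rw [← hy]
      exact hlast x hx
    obtain ⟨hne', hhead', hlast'⟩ := shield_spec hab m
    have hlast_c : ∀ x ∈ (g * shield a b l * c).toWord.getLast?, x = (b, e) := by
      intro x hx
      have hcne : c.toWord ≠ [] := toWord_eq_nil_iff.not.2 hc1
      rw [hw, List.getLast?_append_of_ne_nil _ hcne] at hx
      exact Option.mem_unique hx (h c hcH hc1)
    have hz : (g * shield a b l * c * shield a b m).toWord =
        (g * shield a b l * c).toWord ++ (shield a b m).toWord := by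
      refine toWord_mul_of_isReduced (isReduced_append isReduced_toWord isReduced_toWord ?_)
      intro x hx y hy
      rw [hlast_c x hx]
      exact (hhead' y hy).symm
    have := ih m hred.2 (g * shield a b l * c) hlast_c hne' hhead' hlast' hz
      (by rw [hz, List.getLast?_append_of_ne_nil _ hne'])
    rw [hm]
    simpa [hc, mul_assoc] using this

/-- If the nontrivial elements of `H ≠ 1` end in the same letter, then `H` has a direct complement
whose rank is at most that of the free group. -/
theorem AllEndIn.exists_isCompl [Finite α] {a b : α} (hab : a ≠ b) {e : Bool}
    {H : Subgroup (FreeGroup α)} (h : AllEndIn H (b, e)) (hH : H ≠ ⊥) :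
    ∃ K, IsCompl H K ∧ groupRank K ≤ ENat.card α := by
  have : Infinite H := not_finite_iff_infinite.1 fun _ => hH (eq_bot_of_finite H)
  obtain ⟨m, ⟨r⟩⟩ := Finite.exists_equiv_fin (α × Bool)
  let q : α × Bool ↪ H := (r.toEmbedding.trans Fin.valEmbedding).trans (Infinite.natEmbedding H)
  let p : α × Bool → FreeGroup α := fun l => q l
  have hp : ∀ l, p l ∈ H := fun l => (q l).2
  have hinj : Function.Injective p := Subtype.val_injective.comp q.injective
  let u : α → FreeGroup α := fun i => p (i, true) * shield a b (i, true) * (p (i, false))⁻¹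
  refine ⟨Subgroup.closure (Set.range u), ⟨?_, ?_⟩, groupRank_closure_range_le u⟩
  · rw [Subgroup.disjoint_def]
    intro x hxH hxK
    rw [← range_lift_eq_closure] at hxK
    obtain ⟨y, rfl⟩ := hxK
    rcases hy : y.toWord with _ | ⟨l, L⟩
    · rw [toWord_eq_nil_iff.1 hy, _root_.map_one]
    · have hred : IsReduced (l :: L) := hy ▸ isReduced_toWord
      have := shielded_product_not_mem hab h hp hinj (u := u) (fun _ => rfl) L l hred 1 (by simp)
      refine (this ?_).elim
      have h2 : lift u y = p l * (1 * shield a b l * (p (l.1, !l.2))⁻¹ * lift u (mk L)) := by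
        rw [← mk_toWord (x := y), hy, ← List.singleton_append, ← mul_mk, _root_.map_mul]
        obtain ⟨i, t⟩ := l
        cases t <;> simp [u, shield_not, mul_assoc]
      rw [h2] at hxH
      exact (H.mul_mem_cancel_left (hp l)).1 hxH
  · rw [codisjoint_iff]
    refine mem_of_forall_shield_mem hab _ fun i => ?_
    have h1 : ∀ l, p l ∈ H ⊔ Subgroup.closure (Set.range u) := fun l =>
      (le_sup_left : H ≤ _) (hp l)
    have h2 : u i ∈ H ⊔ Subgroup.closure (Set.range u) :=
      (le_sup_right : Subgroup.closure (Set.range u) ≤ _) (Subgroup.subset_closure ⟨i, rfl⟩)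
    simpa [u, mul_assoc] using mul_mem (mul_mem (inv_mem (h1 (i, true))) h2) (h1 (i, false))

end FreeGroup

/-! ### Finitely generated subgroups and the upper bound -/

namespace FreeGroup

variable {α : Type*} [DecidableEq α]

/-- Every prefix of `L` represents an element whose right coset of `H` meets the ball of
radius `R`. -/
def PrefixesNear (H : Subgroup (FreeGroup α)) (R : ℕ) (L : List (α × Bool)) : Prop :=
  ∀ p, p <+: L → ∃ h ∈ H, (h * mk p).norm ≤ R

variable {H : Subgroup (FreeGroup α)} {R : ℕ}

theorem PrefixesNear.append {L M : List (α × Bool)} (hL : PrefixesNear H R L) (hLH : mk L ∈ H)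
    (hM : PrefixesNear H R M) : PrefixesNear H R (L ++ M) := by
  intro p hp
  rcases List.prefix_or_prefix_of_prefix hp (List.prefix_append L M) with h | ⟨q, rfl⟩
  · exact hL p h
  · obtain ⟨h, hh, hR⟩ := hM q ((List.prefix_append_right_inj L).1 hp)
    refine ⟨h * (mk L)⁻¹, mul_mem hh (inv_mem hLH), ?_⟩
    rwa [← mul_mk, mul_assoc, inv_mul_cancel_left]

theorem PrefixesNear.invRev {L : List (α × Bool)} (hL : PrefixesNear H R L) (hLH : mk L ∈ H) :
    PrefixesNear H R (invRev L) := by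
  rintro p ⟨q, hq⟩
  obtain ⟨h, hh, hR⟩ := hL (FreeGroup.invRev q)
    ⟨FreeGroup.invRev p, by rw [← invRev_append, hq, invRev_invRev]⟩
  refine ⟨h * mk L, mul_mem hh hLH, ?_⟩
  have : mk L * mk p = mk (FreeGroup.invRev q) := by
    rw [← inv_mk, eq_inv_iff_mul_eq_one, mul_assoc, mul_mk, hq, ← inv_mk, mul_inv_cancel]
  rwa [mul_assoc, this]

/-- A prefix of `M` reaching past the deleted pair represents the same element as the prefix of `L`
with the pair reinserted. -/
theorem PrefixesNear.step {L M : List (α × Bool)} (hL : PrefixesNear H R L) (hs : Red.Step L M) :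
    PrefixesNear H R M := by
  obtain @⟨L₁, L₂, x, b⟩ := hs
  intro p hp
  rcases List.prefix_or_prefix_of_prefix hp (List.prefix_append L₁ L₂) with h | ⟨q, rfl⟩
  · exact hL p (h.trans (List.prefix_append _ _))
  · have hq := (List.prefix_append_right_inj L₁).1 hp
    obtain ⟨h, hh, hR⟩ := hL (L₁ ++ (x, b) :: (x, !b) :: q) (by simpa using hq)
    refine ⟨h, hh, ?_⟩
    have : mk (L₁ ++ (x, b) :: (x, !b) :: q) = mk (L₁ ++ q) := Quot.sound Red.Step.not
    rwa [← this]

theorem PrefixesNear.red {L M : List (α × Bool)} (hL : PrefixesNear H R L) (hs : Red L M) :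
    PrefixesNear H R M := by
  induction hs with
  | refl => exact hL
  | tail _ h ih => exact ih.step h

/-- Quasiconvexity of `H`: a product of generators strays from `H` by at most the maximal generator
length, and reduction preserves this. -/
theorem exists_prefixesNear (hH : H.FG) : ∃ R, ∀ h ∈ H, PrefixesNear H R h.toWord := by
  obtain ⟨S, rfl⟩ := hH
  refine ⟨S.sup norm, fun h hh => ?_⟩
  suffices ∃ L, mk L = h ∧ PrefixesNear (Subgroup.closure (S : Set (FreeGroup α))) (S.sup norm) L by
    obtain ⟨L, rfl, hL⟩ := this
    rw [toWord_mk]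
    exact hL.red reduce.red
  induction hh using Subgroup.closure_induction with
  | mem s hs =>
    refine ⟨s.toWord, mk_toWord, fun p hp => ⟨1, one_mem _, ?_⟩⟩
    rw [one_mul]
    exact norm_mk_le.trans (hp.length_le.trans (Finset.le_sup (f := norm) hs))
  | one =>
    refine ⟨[], rfl, fun p hp => ⟨1, one_mem _, ?_⟩⟩
    rw [List.prefix_nil.1 hp, one_mul]
    exact norm_mk_le.trans (Nat.zero_le _)
  | mul x y hx hy ihx ihy =>
    obtain ⟨L, rfl, hL⟩ := ihx
    obtain ⟨M, rfl, hM⟩ := ihy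
    exact ⟨L ++ M, mul_mk.symm, hL.append hx hM⟩
  | inv x hx ihx =>
    obtain ⟨L, rfl, hL⟩ := ihx
    exact ⟨invRev L, inv_mk.symm, hL.invRev hx⟩

theorem finite_norm_le [Finite α] (R : ℕ) : {x : FreeGroup α | x.norm ≤ R}.Finite :=
  (List.finite_length_le (α × Bool) R).preimage toWord_injective.injOn

/-- A subgroup of infinite index has a coset far from `1`; take its element of minimal length. -/
theorem exists_norm_minimal [Finite α] (hH : ¬ H.FiniteIndex) (R : ℕ) :
    ∃ t : FreeGroup α, R < t.norm ∧ ∀ h ∈ H, t.norm ≤ (h * t).norm := by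
  by_contra! hcon
  refine hH ?_
  -- Otherwise every long element can be shortened within its right coset until it enters the finite
  -- ball.
  have key : ∀ x : FreeGroup α, ∃ h ∈ H, (h * x).norm ≤ R := by
    intro x
    induction hx : x.norm using Nat.strong_induction_on generalizing x with
    | _ m ih =>
      by_cases hR : x.norm ≤ R
      · exact ⟨1, one_mem _, by simpa using hR⟩
      · obtain ⟨h, hh, hlt⟩ := hcon x (not_le.1 hR)
        obtain ⟨h', hh', hle⟩ := ih _ (hx ▸ hlt) (h * x) rfl
        exact ⟨h' * h, mul_mem hh' hh, by rwa [mul_assoc]⟩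
  have := (finite_norm_le (α := α) R).to_subtype
  have : Finite (FreeGroup α ⧸ H) := by
    refine Finite.of_surjective
      (fun x : {x : FreeGroup α | x.norm ≤ R} => (((x : FreeGroup α)⁻¹ : FreeGroup α) : FreeGroup α ⧸ H)) ?_
    intro y
    obtain ⟨y, rfl⟩ := QuotientGroup.mk_surjective y
    obtain ⟨h, hh, hle⟩ := key y⁻¹
    refine ⟨⟨h * y⁻¹, hle⟩, QuotientGroup.eq.2 ?_⟩
    simpa using hh
  exact Subgroup.finiteIndex_of_finite_quotient

theorem _root_.List.exists_common_prefix {β : Type*} (L M : List β) :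
    ∃ p r s, L = p ++ r ∧ M = p ++ s ∧ ∀ x ∈ r.head?, ∀ y ∈ s.head?, x ≠ y := by
  induction L generalizing M with
  | nil => exact ⟨[], [], M, rfl, rfl, by simp⟩
  | cons x L ih =>
    cases M with
    | nil => exact ⟨[], x :: L, [], rfl, rfl, by simp⟩
    | cons y M =>
      by_cases hxy : x = y
      · obtain ⟨p, r, s, rfl, rfl, h⟩ := ih M
        exact ⟨x :: p, r, s, rfl, by rw [hxy]; rfl, h⟩
      · exact ⟨[], x :: L, y :: M, rfl, rfl, by simpa using hxy⟩

/-- Only the common prefix cancels, and `k`, being different and no shorter, extends beyond it. -/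
theorem getLast?_toWord_inv_mul {t k : FreeGroup α} (hle : t.norm ≤ k.norm) (hne : t ≠ k) :
    (t⁻¹ * k).toWord.getLast? = k.toWord.getLast? := by
  obtain ⟨p, r, s, ht, hk, h⟩ := List.exists_common_prefix t.toWord k.toWord
  have hs : s ≠ [] := by
    rintro rfl
    have hr : r = [] := by
      rw [norm, norm, ht, hk] at hle
      simpa using hle
    exact hne (toWord_injective (by rw [ht, hk, hr]))
  have hred : IsReduced (invRev r ++ s) := by
    have h1 : IsReduced r := isReduced_toWord.infix ⟨p, [], by rw [List.append_nil, ht]⟩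
    have h2 : IsReduced s := isReduced_toWord.infix ⟨p, [], by rw [List.append_nil, hk]⟩
    refine List.isChain_append.2 ⟨?_, h2, ?_⟩
    · have h3 : (mk r)⁻¹.toWord = invRev r := by rw [toWord_inv, toWord_mk_of_isReduced h1]
      exact h3 ▸ isReduced_toWord
    · intro x hx y hy
      rw [getLast?_invRev] at hx
      simp only [Option.mem_def, Option.map_eq_some_iff] at hx
      obtain ⟨⟨i, b⟩, hz, rfl⟩ := hx
      intro hi
      have := h _ hz _ hy
      obtain ⟨j, c⟩ := y
      simp only at hi
      subst hi
      cases b <;> cases c <;> simp_all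
  have : (t⁻¹ * k).toWord = invRev r ++ s := by
    rw [← toWord_mk_of_isReduced hred, ← mul_mk, ← inv_mk, ← mk_toWord (x := t),
      ← mk_toWord (x := k), ht, hk, ← mul_mk, ← mul_mk]
    group
  rw [this, hk, List.getLast?_append_of_ne_nil _ hs, List.getLast?_append_of_ne_nil _ hs]

/-- A finitely generated subgroup of infinite index has a conjugate whose nontrivial elements end
in the same letter. -/
theorem exists_allEndIn_conj [Finite α] (hH : H.FG) (hi : ¬ H.FiniteIndex) :
    ∃ (t : FreeGroup α) (x : α × Bool), AllEndIn (H.map (MulAut.conj t⁻¹).toMonoidHom) x := by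
  obtain ⟨R, hR⟩ := exists_prefixesNear hH
  obtain ⟨t, htR, hmin⟩ := exists_norm_minimal hi R
  have ht0 : t.toWord ≠ [] := by
    intro h0
    simp [norm, h0] at htR
  obtain ⟨w, ⟨i, e⟩, hw⟩ : ∃ w x, t.toWord = w ++ [x] :=
    ⟨_, _, (List.dropLast_append_getLast ht0).symm⟩
  have htw : t = mk w * mk [(i, e)] := by rw [mul_mk, ← hw, mk_toWord]
  have hwred : IsReduced w := isReduced_toWord.infix ⟨[], [(i, e)], hw.symm⟩
  -- If the last letter of `t` cancelled, `t` would be a prefix of `h⁻¹`, so its coset would meet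
  -- the ball of radius `R`, against minimality.
  have hlast : ∀ h ∈ H, (i, e) ∈ (h * t).toWord.getLast? := by
    intro h hh
    set g := h * mk w with hg
    by_cases hgl : (i, !e) ∈ g.toWord.getLast?
    · exfalso
      obtain ⟨v, hv⟩ := List.mem_getLast?_eq_getLast hgl |>.elim fun h0 h1 =>
        (⟨_, by rw [h1, List.dropLast_append_getLast h0]⟩ : ∃ v, v ++ [(i, !e)] = g.toWord)
      have hinv : g⁻¹.toWord = (i, e) :: invRev v := by simp [toWord_inv, ← hv, invRev]
      have hcat : IsReduced (w ++ [(i, e)] ++ invRev v) := by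
        refine IsReduced.append_overlap (hw ▸ isReduced_toWord) ?_ (by simp)
        exact (hinv ▸ isReduced_toWord : IsReduced ((i, e) :: invRev v))
      have hword : h⁻¹.toWord = t.toWord ++ invRev v := by
        rw [hw, ← toWord_mk_of_isReduced hcat, List.append_assoc, List.singleton_append, ← hinv,
          ← mul_mk, mk_toWord, hg]
        group
      obtain ⟨h', hh', hle⟩ := hR h⁻¹ (inv_mem hh) t.toWord ⟨_, hword.symm⟩
      rw [mk_toWord] at hle
      exact absurd (hmin h' hh') (by omega)
    · have : (h * t).toWord = g.toWord ++ [(i, e)] := by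
        rw [htw, ← mul_assoc, ← hg]
        have h1 : (mk [(i, e)]).toWord = [(i, e)] := toWord_mk_of_isReduced (by simp)
        rw [toWord_mul_of_isReduced, h1]
        rw [h1]
        refine List.isChain_append.2 ⟨isReduced_toWord, by simp, ?_⟩
        rintro ⟨j, c⟩ hx y hy hj
        simp only [List.head?_cons, Option.mem_def, Option.some_inj] at hy
        subst hy
        simp only at hj ⊢
        subst hj
        by_contra hc
        exact hgl (by rwa [Bool.eq_not_of_ne hc] at hx)
      simp [this]
  refine ⟨t, (i, e), ?_⟩
  rintro _ ⟨h, hh, rfl⟩ hne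
  have hconj : (MulAut.conj t⁻¹).toMonoidHom h = t⁻¹ * (h * t) := by simp [mul_assoc]
  rw [hconj] at hne ⊢
  rw [getLast?_toWord_inv_mul (hmin h hh) fun h0 => hne (inv_mul_eq_one.2 h0)]
  exact hlast h hh

/-- Over a single letter, a reduced word repeats one signed letter, but here its first and last
letters are mutually inverse. -/
theorem AllEndIn.exists_ne {i : α} {e : Bool} (h : AllEndIn H (i, e)) (hH : H ≠ ⊥) :
    ∃ a, a ≠ i := by
  by_contra! hall
  have : Subsingleton α := ⟨fun a b => (hall a).trans (hall b).symm⟩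
  obtain ⟨c, hc, hc1⟩ := H.bot_or_exists_ne_one.resolve_left hH
  have h1 := h c hc hc1
  have h2 := h.head hc hc1
  have hred : IsReduced c.toWord := isReduced_toWord
  rcases hw : c.toWord with _ | ⟨y, L⟩
  · simp [hw] at h1
  · rw [hw] at h1 h2 hred
    have h3 := hred.eq_of_mem _ (List.mem_of_mem_getLast? h1)
    simp only [List.head?_cons, Option.mem_def, Option.some_inj] at h2
    rw [h2] at h3
    simp at h3

/-- The corank of a finitely generated complemented subgroup is at most the rank of the free
group. -/
theorem directCorank_le_card [Finite α] (hH : H.FG) (hc : IsComplemented H) :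
    directCorank H ≤ ENat.card α := by
  by_cases hi : H.FiniteIndex
  · obtain ⟨K, hK⟩ := hc
    have hinj : Function.Injective fun k : K => ((k : FreeGroup α) : FreeGroup α ⧸ H) := by
      intro x y hxy
      have hmem := QuotientGroup.eq.1 hxy
      exact Subtype.ext (inv_mul_eq_one.1
        (Subgroup.disjoint_def.1 hK.disjoint hmem (mul_mem (inv_mem x.2) y.2)))
    have : Finite K := Finite.of_injective _ hinj
    have hK' := eq_bot_of_finite K
    subst hK'
    exact (directCorank_le hK).trans (by simp [groupRank_bot])
  · by_cases hb : H = ⊥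
    · subst hb
      refine (directCorank_le isCompl_bot_top).trans ?_
      rw [← closure_range_of]
      exact groupRank_closure_range_le _
    · obtain ⟨t, ⟨i, e⟩, ht⟩ := exists_allEndIn_conj hH hi
      set φ := MulAut.conj t⁻¹
      have hb' : H.map φ.toMonoidHom ≠ ⊥ := by
        rwa [Ne, (H.map_eq_bot_iff_of_injective φ.injective)]
      obtain ⟨a, ha⟩ := ht.exists_ne hb'
      obtain ⟨K, hK, hr⟩ := ht.exists_isCompl ha hb'
      have hH2 : (H.map φ.toMonoidHom).map φ.symm.toMonoidHom = H := by
        ext x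
        simp [Subgroup.mem_map]
      have hK2 : IsCompl H (K.map φ.symm.toMonoidHom) := by
        have : IsCompl ((H.map φ.toMonoidHom).map φ.symm.toMonoidHom)
          (K.map φ.symm.toMonoidHom) := (φ.symm.mapSubgroup).isCompl hK
        rwa [hH2] at this
      exact (directCorank_le hK2).trans ((groupRank_map_le _ K).trans hr)

end FreeGroup

/-! ### Realization of ranks and coranks -/

/-- Homomorphisms to a semidirect product with a vector space compute the rank of a subgroup that
they map to the vector space. -/
theorem groupRank_closure_range_eq {G V Q ι : Type*} [Group G] [AddCommGroup V] [Module ℚ V]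
    [Group Q] {φ : Q →* MulAut (Multiplicative V)} (Θ : G →* Multiplicative V ⋊[φ] Q) {u : ι → G}
    {v : ι → V} (hu : ∀ i, Θ (u i) = SemidirectProduct.inl (Multiplicative.ofAdd (v i)))
    (hv : LinearIndependent ℚ v) :
    groupRank (Subgroup.closure (Set.range u)) = ENat.card ι := by
  refine le_antisymm (groupRank_closure_range_le u) ?_
  have hker : ∀ x ∈ Subgroup.closure (Set.range u), (Θ x).right = 1 := by
    have : Subgroup.closure (Set.range u) ≤ (SemidirectProduct.rightHom.comp Θ).ker := by
      rw [Subgroup.closure_le]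
      rintro _ ⟨i, rfl⟩
      simp [MonoidHom.mem_ker, hu]
    intro x hx
    simpa [MonoidHom.mem_ker] using this hx
  -- The left component is multiplicative here because the right component is trivial.
  let f : Subgroup.closure (Set.range u) →* Multiplicative V :=
    { toFun := fun x => (Θ x).left
      map_one' := by simp
      map_mul' := fun x y => by simp [hker x x.2] }
  refine card_le_groupRank f (fun i => ⟨u i, Subgroup.subset_closure ⟨i, rfl⟩⟩) ?_
  simpa [f, hu] using hv

namespace FreeGroup

variable {α : Type*} [DecidableEq α]

/-- The automorphism that moves every `ℤ`-coordinate up by one. -/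
noncomputable def shift (β : Type*) : MulAut (Multiplicative (β × ℤ →₀ ℚ)) :=
  AddEquiv.toMultiplicative
    (Finsupp.domCongr (Equiv.prodCongr (Equiv.refl β) (Equiv.addRight (1 : ℤ))))

theorem shift_pow_single {β : Type*} (i : β) (k : ℕ) :
    (shift β ^ k) (Multiplicative.ofAdd (Finsupp.single (i, 0) 1)) =
      Multiplicative.ofAdd (Finsupp.single (i, (k : ℤ)) 1) := by
  induction k with
  | zero => simp
  | succ k ih =>
    rw [pow_succ', MulAut.mul_apply, ih]
    simp [shift]

/-- The homomorphism to the wreath product that sends `b` to the shift. -/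
noncomputable def toWreath (b : α) : FreeGroup α →*
    Multiplicative (α × ℤ →₀ ℚ) ⋊[zpowersHom _ (shift α)] Multiplicative ℤ :=
  lift fun i => if i = b then SemidirectProduct.inr (Multiplicative.ofAdd 1)
    else SemidirectProduct.inl (Multiplicative.ofAdd (Finsupp.single (i, 0) 1))

/-- The conjugate of the letter `i` by `b ^ k`. -/
def powConj (b i : α) (k : ℕ) : FreeGroup α := of b ^ k * of i * (of b ^ k)⁻¹

theorem toWreath_powConj {b i : α} (hi : i ≠ b) (k : ℕ) :
    toWreath b (powConj b i k) =
      SemidirectProduct.inl (Multiplicative.ofAdd (Finsupp.single (i, (k : ℤ)) 1)) := by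
  rw [← shift_pow_single]
  have : shift α ^ k = zpowersHom _ (shift α) (Multiplicative.ofAdd 1 ^ k) := by
    simp
  rw [this, SemidirectProduct.inl_aut]
  simp [toWreath, powConj, hi]

/-- Reading `L` from height `h`, the letters `b` and `b⁻¹` go up and down, the height is positive
at all other letters, and it is zero at the end. -/
def Descends (b : α) : ℤ → List (α × Bool) → Prop
  | h, [] => h = 0
  | h, (x, e) :: L => if x = b then Descends b (h + if e then 1 else -1) L
      else 0 < h ∧ Descends b h L

theorem Descends.append {b : α} {L M : List (α × Bool)} {h : ℤ} (hL : Descends b h L)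
    (hM : Descends b 0 M) : Descends b h (L ++ M) := by
  induction L generalizing h with
  | nil =>
    rw [Descends] at hL
    simpa [hL] using hM
  | cons l L ih =>
    obtain ⟨x, e⟩ := l
    rw [List.cons_append]
    unfold Descends at hL ⊢
    split_ifs at hL ⊢
    · exact ih hL
    · exact ih hL
    · exact ⟨hL.1, ih hL.2⟩

theorem Descends.step {b : α} {L M : List (α × Bool)} {h : ℤ} (hL : Descends b h L)
    (hs : Red.Step L M) : Descends b h M := by
  obtain @⟨L₁, L₂, x, e⟩ := hs
  induction L₁ generalizing h with
  | nil =>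
    by_cases hx : x = b <;> cases e <;> simp_all [Descends]
  | cons l L₁ ih =>
    obtain ⟨y, c⟩ := l
    rw [List.cons_append] at hL ⊢
    unfold Descends at hL ⊢
    split_ifs at hL ⊢
    · exact ih hL
    · exact ih hL
    · exact ⟨hL.1, ih hL.2⟩

theorem Descends.red {b : α} {L M : List (α × Bool)} {h : ℤ} (hL : Descends b h L)
    (hs : Red L M) : Descends b h M := by
  induction hs with
  | refl => exact hL
  | tail _ hs ih => exact ih.step hs

theorem descends_replicate_append (b : α) (e : Bool) (k : ℕ) (h : ℤ) (L : List (α × Bool)) :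
    Descends b h (List.replicate k (b, e) ++ L) ↔ Descends b (h + if e then (k : ℤ) else -k) L := by
  induction k generalizing h with
  | zero => simp
  | succ k ih =>
    rw [List.replicate_succ, List.cons_append, Descends, if_pos rfl, ih]
    have : (h + if e then 1 else -1) + (if e then (k : ℤ) else -k) =
        h + if e then ((k + 1 : ℕ) : ℤ) else -((k + 1 : ℕ) : ℤ) := by
      cases e <;> simp <;> ring
    rw [this]

/-- After `b⁻¹`, reducedness forbids `b` and negative height forbids other letters, so the height
never returns to zero. -/
theorem not_descends_of_neg {b : α} {L : List (α × Bool)} (hL : IsReduced ((b, false) :: L)) {h : ℤ}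
    (hh : h < 0) : ¬ Descends b h L := by
  induction L generalizing h with
  | nil => exact hh.ne
  | cons l L ih =>
    obtain ⟨x, e⟩ := l
    rw [Descends]
    split_ifs with hx he
    · subst hx
      simp [he] at hL
    · subst hx
      obtain rfl : e = false := by simpa using he
      exact ih (isReduced_cons_cons.1 hL).2 (by omega)
    · exact fun h0 => absurd h0.1 (by omega)

/-- The generators and their inverses descend, with `a^±1` read at height `k + 1 > 0`; concatenation
and reduction preserve this. -/
theorem descends_toWord {a b : α} (hab : a ≠ b) {x : FreeGroup α}
    (hx : x ∈ Subgroup.closure (Set.range fun k : ℕ => powConj b a (k + 1))) :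
    Descends b 0 x.toWord := by
  have hgen : ∀ (k : ℕ) (e : Bool), Descends b 0
      (List.replicate (k + 1) (b, true) ++ ((a, e) :: (List.replicate (k + 1) (b, false) ++ []))) := by
    intro k e
    rw [descends_replicate_append, Descends, if_neg hab, descends_replicate_append]
    refine ⟨by rw [if_pos rfl]; omega, ?_⟩
    simp [Descends]
  have hpow : ∀ k : ℕ, of b ^ k = mk (List.replicate k (b, true)) := fun k => by
    rw [← toWord_of_pow, mk_toWord]
  have hmk : ∀ k : ℕ, powConj b a (k + 1) = mk (List.replicate (k + 1) (b, true) ++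
      ((a, true) :: (List.replicate (k + 1) (b, false) ++ []))) := by
    intro k
    rw [powConj, hpow, of, inv_mk, mul_mk, mul_mk]
    simp [invRev]
  suffices ∃ L, mk L = x ∧ Descends b 0 L by
    obtain ⟨L, rfl, hL⟩ := this
    rw [toWord_mk]
    exact hL.red reduce.red
  induction hx using Subgroup.closure_induction'' with
  | mem x hx =>
    obtain ⟨k, rfl⟩ := hx
    exact ⟨_, (hmk k).symm, hgen k true⟩
  | inv_mem x hx =>
    obtain ⟨k, rfl⟩ := hx
    refine ⟨_, ?_, hgen k false⟩
    simp only [hmk, inv_mk]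
    simp [invRev]
  | one => exact ⟨[], rfl, rfl⟩
  | mul x y _ _ hx hy =>
    obtain ⟨L, rfl, hL⟩ := hx
    obtain ⟨M, rfl, hM⟩ := hy
    exact ⟨L ++ M, mul_mk.symm, hL.append hM⟩

theorem allEndIn_closure_powConj {a b : α} (hab : a ≠ b) :
    AllEndIn (Subgroup.closure (Set.range fun k : ℕ => powConj b a (k + 1))) (b, false) := by
  intro c hc hc1
  have hd := descends_toWord hab (inv_mem hc)
  have hred : IsReduced c⁻¹.toWord := isReduced_toWord
  have hw : c.toWord.getLast? = c⁻¹.toWord.head?.map fun x => (x.1, !x.2) := by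
    rw [← getLast?_invRev, ← toWord_inv, inv_inv]
  rw [hw]
  rcases h : c⁻¹.toWord with _ | ⟨⟨x, e⟩, L⟩
  · exact absurd (inv_eq_one.1 (toWord_eq_nil_iff.1 h)) hc1
  · rw [h] at hd hred
    rw [Descends] at hd
    split_ifs at hd with hx he
    · simp [hx, he]
    · obtain rfl : e = false := by simpa using he
      subst hx
      exact (not_descends_of_neg hred (by omega) hd).elim
    · exact absurd hd.1 (lt_irrefl _)

/-- Subgroups of the commutator subgroup of every rank, with maximal corank. -/
theorem exists_directCorank_eq_card [Finite α] [Nontrivial α] {r : ℕ∞} (hr : 1 ≤ r) :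
    ∃ H : Subgroup (FreeGroup α), IsComplemented H ∧ groupRank H = r ∧
      directCorank H = ENat.card α := by
  obtain ⟨a, b, hab⟩ := exists_pair_ne α
  obtain ⟨T, -, hT⟩ := Set.exists_subset_encard_eq (s := (Set.univ : Set ℕ)) (k := r) (by simp)
  -- The quotients have zero exponents; the exponents `k + 2` avoid the base exponent `1`, and all
  -- are positive.
  let u : T → FreeGroup α := fun k => powConj b a (k + 2) * (powConj b a 1)⁻¹
  have hrank : groupRank (Subgroup.closure (Set.range u)) = r := by
    rw [← hT]
    let v : T → α × ℤ →₀ ℚ := fun k =>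
      Finsupp.single (a, ((k + 2 : ℕ) : ℤ)) 1 - Finsupp.single (a, ((1 : ℕ) : ℤ)) 1
    refine groupRank_closure_range_eq (toWreath b) (v := v) (fun k => ?_) ?_
    · rw [_root_.map_mul, _root_.map_inv, toWreath_powConj hab, toWreath_powConj hab,
        ← _root_.map_inv, ← _root_.map_mul, ← ofAdd_neg, ← ofAdd_add, ← sub_eq_add_neg]
    -- Killing the base vector turns `v` into distinct basis vectors.
    · let l : (α × ℤ →₀ ℚ) →ₗ[ℚ] (α × ℤ →₀ ℚ) :=
        Finsupp.linearCombination ℚ fun q => if q = (a, 1) then 0 else Finsupp.single q 1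
      refine LinearIndependent.of_comp l ?_
      have hl : l ∘ v = (fun q : α × ℤ => Finsupp.single q (1 : ℚ)) ∘
          fun k : T => (a, ((k + 2 : ℕ) : ℤ)) := by
        ext1 k
        have hk : ((k : ℕ) : ℤ) + 2 ≠ 1 := by omega
        simp [l, v, hk]
      rw [hl]
      refine (Finsupp.linearIndependent_single_one ℚ _).comp _ fun k m hkm => ?_
      simpa [Subtype.ext_iff] using hkm
  have hle : Subgroup.closure (Set.range u) ≤
      Subgroup.closure (Set.range fun k : ℕ => powConj b a (k + 1)) := by
    rw [Subgroup.closure_le]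
    rintro _ ⟨k, rfl⟩
    exact mul_mem (Subgroup.subset_closure ⟨k + 1, rfl⟩)
      (inv_mem (Subgroup.subset_closure ⟨0, rfl⟩))
  have hend : AllEndIn (Subgroup.closure (Set.range u)) (b, false) :=
    fun c hc => allEndIn_closure_powConj hab c (hle hc)
  have hbot : Subgroup.closure (Set.range u) ≠ ⊥ := by
    intro h0
    rw [h0, groupRank_bot] at hrank
    simp [← hrank] at hr
  obtain ⟨K, hK, hKr⟩ := hend.exists_isCompl hab hbot
  refine ⟨_, ⟨K, hK⟩, hrank, le_antisymm ((directCorank_le hK).trans hKr) ?_⟩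
  refine card_le_directCorank (exponents fun i : α => Finsupp.single i 1) ?_ of ?_
  · rw [Subgroup.closure_le]
    rintro _ ⟨k, rfl⟩
    simp [MonoidHom.mem_ker, u, powConj]
  · simpa [exponents] using Finsupp.linearIndependent_single_one ℚ α

/-- A subgroup generated by conjugates of the letters outside `M`, including these letters, has the
subgroup on the letters in `M` as a complement of minimal rank. -/
theorem exists_directCorank_eq_encard {M : Set α} {b : α} (hb : b ∈ M) {T : Set (α × ℕ)}
    (hT : ∀ q ∈ T, q.1 ∉ M) (hT0 : ∀ i ∉ M, (i, 0) ∈ T) :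
    ∃ H : Subgroup (FreeGroup α), IsComplemented H ∧ groupRank H = T.encard ∧
      directCorank H = M.encard := by
  let u : T → FreeGroup α := fun q => powConj b q.1.1 q.1.2
  have hne : ∀ q : T, q.1.1 ≠ b := fun q h => hT q q.2 (h ▸ hb)
  have hrank : groupRank (Subgroup.closure (Set.range u)) = T.encard :=
    groupRank_closure_range_eq (toWreath b) (fun q => toWreath_powConj (hne q) _) <|
      (Finsupp.linearIndependent_single_one ℚ (α × ℤ)).comp
        (fun q : T => (q.1.1, (q.1.2 : ℤ))) fun q q' h => by
          simpa [Prod.ext_iff, Subtype.ext_iff] using h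
  have hcompl : IsCompl (Subgroup.closure (Set.range u)) (Subgroup.closure (of '' M)) := by
    constructor
    · classical
      -- This retraction kills `H` and fixes the proposed complement.
      let π : FreeGroup α →* FreeGroup α := lift fun i => if i ∈ M then of i else 1
      have h1 : Subgroup.closure (Set.range u) ≤ π.ker := by
        rw [Subgroup.closure_le]
        rintro _ ⟨q, rfl⟩
        simp [MonoidHom.mem_ker, u, powConj, π, hT q q.2]
      have h2 : Subgroup.closure (of '' M) ≤ π.eqLocus (MonoidHom.id _) := by
        rw [Subgroup.closure_le]
        rintro _ ⟨i, hi, rfl⟩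
        change π (of i) = of i
        simp [π, hi]
      rw [Subgroup.disjoint_def]
      intro x hx hx'
      rw [← MonoidHom.mem_ker.1 (h1 hx)]
      exact (h2 hx').symm
    · rw [codisjoint_iff, eq_top_iff, ← closure_range_of, Subgroup.closure_le]
      rintro _ ⟨i, rfl⟩
      by_cases hi : i ∈ M
      · exact SetLike.le_def.1 le_sup_right (Subgroup.subset_closure ⟨i, hi, rfl⟩)
      · exact SetLike.le_def.1 le_sup_left
          (Subgroup.subset_closure ⟨⟨_, hT0 i hi⟩, by simp [u, powConj]⟩)
  refine ⟨_, ⟨_, hcompl⟩, hrank, le_antisymm ?_ ?_⟩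
  · exact (directCorank_le hcompl).trans
      ((groupRank_closure_le _).trans (Set.encard_image_le _ _))
  · classical
    refine card_le_directCorank (ι := M)
      (exponents fun i : α => if i ∈ M then Finsupp.single i 1 else 0) ?_ (fun i => of i) ?_
    · rw [Subgroup.closure_le]
      rintro _ ⟨q, rfl⟩
      simp [MonoidHom.mem_ker, u, powConj, exponents, hT q q.2]
    · have := (Finsupp.linearIndependent_single_one ℚ α).comp ((↑) : M → α) Subtype.val_injective
      simpa [exponents, Function.comp_def] using this

end FreeGroup

theorem mainTheorem9 (n : ℕ) :
    (∀ H : Subgroup (FreeGroup (Fin n)), IsComplemented H →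
      -- the subtraction in `ℕ∞` is truncated at `0`, and `n - ⊤ = 0`
      max 0 ((n : ℕ∞) - groupRank H) ≤ directCorank H ∧
      (H.FG → directCorank H ≤ n)) ∧
    (1 < n → ∀ (r : ℕ∞) (c : ℕ), 1 ≤ r → 1 ≤ c → c ≤ n → (n : ℕ∞) - r ≤ c →
      ∃ H : Subgroup (FreeGroup (Fin n)),
        IsComplemented H ∧ groupRank H = r ∧ directCorank H = c) := by
  refine ⟨fun H hH => ⟨?_, fun hfg => ?_⟩, fun hn r c hr hc hcn hnr => ?_⟩
  · simpa using sub_groupRank_le_directCorank H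
  · simpa using FreeGroup.directCorank_le_card hfg hH
  · rcases hcn.eq_or_lt with rfl | hlt
    · have : Nontrivial (Fin c) := Fin.nontrivial_iff_two_le.2 hn
      simpa using FreeGroup.exists_directCorank_eq_card (α := Fin c) hr
    · obtain ⟨M, -, hM⟩ := Set.exists_subset_encard_eq (s := (Set.univ : Set (Fin n)))
        (k := (c : ℕ∞)) (by simpa using hcn)
      have hadd : M.encard + Mᶜ.encard = n := by simpa using Set.encard_add_encard_compl M
      obtain ⟨b, hb⟩ : M.Nonempty := by
        rw [← Set.encard_ne_zero, hM]
        exact_mod_cast (by omega : c ≠ 0)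
      obtain ⟨i, hi⟩ : Mᶜ.Nonempty := by
        rw [← Set.encard_ne_zero]
        intro h0
        rw [h0, hM, add_zero] at hadd
        exact hlt.ne (by exact_mod_cast hadd)
      -- This is `n - r ≤ c`: the `n - c` mandatory generators fit into a set of size `r`.
      have hle : Mᶜ.encard ≤ r := by
        rw [tsub_le_iff_right, ← hadd, hM] at hnr
        exact (ENat.add_le_add_iff_left (ENat.natCast_ne_top c)).1 hnr
      have hinf : (Mᶜ ×ˢ (Set.univ : Set ℕ)).encard = ⊤ := by
        rw [Set.encard_eq_top_iff]
        exact (Set.infinite_univ).prod_right ⟨i, hi⟩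
      obtain ⟨T, hT0, hT, hTr⟩ := Set.exists_superset_subset_encard_eq
        (s := (fun i => (i, 0)) '' Mᶜ) (t := Mᶜ ×ˢ (Set.univ : Set ℕ)) (k := r)
        (by rintro _ ⟨i, hi, rfl⟩; exact ⟨hi, trivial⟩)
        ((Set.encard_image_le _ _).trans hle) (by simp [hinf])
      rw [← hTr, ← hM]
      exact FreeGroup.exists_directCorank_eq_encard hb (fun q hq => (hT hq).1)
        fun i hi => hT0 ⟨i, hi, rfl⟩
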